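/- Let $p\ge 5$ be an integer and write $c=p-4$, $d=p-3$, $x=p-2$. Define $m_0=1$, $m_1=p-2$, $m_{n+2}=(p-2)m_{n+1}-m_n$. A non-zero metallic code (nzm-code) of a positive integer $n$ is a word $a_k\ldots a_0$ of digits $a_i\in\{1,\ldots,x\}$ with $n=\sum_{i=0}^k a_i m_i$ in which no block $x\,d^{j}\,x$ ($j\ge 0$) occurs. Every positive integer $n$ has exactly one nzm-code, denoted by $[n]$; its last digit is called the signature of $n$. The successor of $\nu$ is the integer whose nzm-code is $[\nu]1$. The black metallic tree $\mathcal B$ is the infinite tree with black root in which each black node has $p-3$ sons and each white node has $p-2$ sons, exactly one son of each node being black; the nodes are numbered $1,2,3,\ldots$ level by level from left to right, starting from the root. An assignment $\alpha$ on $\mathcal B$ is a choice, for each node, of the position of the black son among its sons; it determines the status (black or white) of each node and the interval of integers formed by its sons (the $\alpha$-sons). The rightmost assignment $\rho$ makes the rightmost son of each node black, and $\mathcal B_\rho$ is $\mathcal B$ with this assignment. For a digit $a\in\{1,\ldots,x\}$, an assignment $\alpha$ has the preferred son property for $a$ if each node $\nu$ has exactly one $\alpha$-son whose nzm-code is $[\nu]a$.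 Theorem. 1. $\mathcal B_\rho$, each node being labelled by its status ($\mathbf b$ or $\mathbf w$) and its signature, is generated by the following rules, which give the labels of the sons of a node from left to right. The root: $\mathbf w2,\ldots,\mathbf wd,\mathbf bx$. Any other black node: $\mathbf w1,\ldots,\mathbf wc,\mathbf bd$. A white node of signature $a$ with $1<a<x$: $\mathbf w1,\ldots,\mathbf wd,\mathbf bx$. A white node of signature $1$ or $x$: $\mathbf wx,\mathbf w1,\ldots,\mathbf wc,\mathbf bd$. 2. The nzm-code of the $h$-th $\rho$-son of a node $\nu$ is as follows. If $\nu$ is the root: the one-digit word $h+1$ for $1\le h\le p-4$, and $x$ for $h=p-3$. If $\nu$ is another black node: $[\nu-1]h$ for $1\le h\le p-3$. If $\nu$ is a white node of signature $1$ or $x$: $[\nu-2]x$ for $h=1$, and $[\nu-1](h-1)$ for $2\le h\le p-2$. If $\nu$ is a white node of any other signature: $[\nu-1]h$ for $1\le h\le p-3$, and $[\nu-1]x$ for $h=p-2$. 3. The successor of each node $\nu$ is the leftmost or the second $\rho$-son of the node $\nu+1$. 4. The assignment $\rho$ does not have the preferred son property for any digit $a\in\{1,\ldots,x\}$. No assignment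 $\alpha$ on $\mathcal B$ has the preferred son property for any digit $a\in\{1,\ldots,x\}$; indeed, under no assignment does any node $\nu$ have a son whose nzm-code is $[\nu]a$. -/

import Mathlib

namespace MetallicTree

/-! Throughout, `p ≥ 5`.  The three largest digits are `c = p - 4`, `d = p - 3`, `x = p - 2`. -/

/-! ### Metallic numbers and non-zero metallic codes -/

/-- The metallic sequence: `m₀ = 1`, `m₁ = p - 2`, `m_{n+2} = (p - 2) m_{n+1} - m_n`. -/
def metallic (p : ℕ) : ℕ → ℤ
  | 0 => 1
  | 1 => (p : ℤ) - 2
  | n + 2 => ((p : ℤ) - 2) * metallic p (n + 1) - metallic p n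

/-- The number written by the word `a_k .. a_1 a_0` (a list, leftmost digit first):
`∑ i, a_i m_i`. -/
def value (p : ℕ) : List ℕ → ℤ
  | [] => 0
  | a :: w => (a : ℤ) * metallic p w.length + value p w

/-- The word contains the pattern `x d^k x` for some `k ≥ 0` as a block of consecutive digits. -/
def HasForbiddenPattern (p : ℕ) (w : List ℕ) : Prop :=
  ∃ k : ℕ, ([p - 2] ++ List.replicate k (p - 3) ++ [p - 2]) <:+: w

/-- `w` is a non-zero metallic code (nzm-code) of `n`. -/
structure IsNzmCode (p n : ℕ) (w : List ℕ) : Prop where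
  digits : ∀ a ∈ w, 1 ≤ a ∧ a ≤ p - 2
  allowed : ¬ HasForbiddenPattern p w
  value_eq : value p w = (n : ℤ)

/-- `[n]_nz`, the nzm-code of `n`. -/
noncomputable def nzmCode (p n : ℕ) : List ℕ :=
  Classical.epsilon (IsNzmCode p n)

/-- The nzm-signature of `n`: the rightmost digit of its nzm-code. -/
noncomputable def nzmSignature (p n : ℕ) : ℕ :=
  (nzmCode p n).getLastD 0

/-- `σ` is the successor of `ν`: the node whose nzm-code is `[ν]_nz 1`. -/
def IsSuccessor (p ν σ : ℕ) : Prop :=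
  1 ≤ σ ∧ nzmCode p σ = nzmCode p ν ++ [1]

/-! ### The black metallic tree and its assignments

Nodes are identified with their natural numbers: the root is `1`, and the nodes are numbered
level by level, from left to right, so that the sons of `ν + 1` (or, if `ν` is the last node of
its level, the sons of the first node of the next level) come just after the sons of `ν`. -/

/-- The literal status of a node. -/
inductive Status where
  | black
  | white

/-- The numerical status: `1` for black, `0` for white. -/
def Status.num : Status → ℕ
  | .black => 1
  | .white => 0

/-- A black node has `p - 3` sons, a white node has `p - 2` sons. -/
def sonCount (p : ℕ) (s : Status) : ℕ := p - 2 - s.num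

/-- An assignment `α` on the black metallic tree: for each node `ν`, its leftmost son
`first ν`, the position `pos ν` of its unique black son among its sons (the leftmost position
is `1`), and its status `stat ν`.  Only the values at positive integers matter. -/
structure Assignment (p : ℕ) where
  first : ℕ → ℕ
  pos : ℕ → ℕ
  stat : ℕ → Status
  stat_root : stat 1 = Status.black
  first_root : first 1 = 2
  first_succ : ∀ ν, 1 ≤ ν → first (ν + 1) = first ν + sonCount p (stat ν)
  pos_mem : ∀ ν, 1 ≤ ν → 1 ≤ pos ν ∧ pos ν ≤ sonCount p (stat ν)
  stat_son : ∀ ν, 1 ≤ ν → ∀ i, i < sonCount p (stat ν) →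
    (stat (first ν + i) = Status.black ↔ i + 1 = pos ν)

/-- The `α`-sons of `ν`, from left to right. -/
def Assignment.sons {p : ℕ} (α : Assignment p) (ν : ℕ) : List ℕ :=
  (List.range (sonCount p (α.stat ν))).map fun i => α.first ν + i

/-- The preferred son property for the digit `a`: each node `ν` has exactly one `α`-son whose
nzm-code is `[ν]_nz a`. -/
def Assignment.HasPreferredSons {p : ℕ} (α : Assignment p) (a : ℕ) : Prop :=
  ∀ ν, 1 ≤ ν → ∃! σ, σ ∈ α.sons ν ∧ nzmCode p σ = nzmCode p ν ++ [a]

/-! ### The rightmost assignment -/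

/-- The statuses of the sons of a node of status `s`, the black son being the rightmost one. -/
def rightmostRow (p : ℕ) (s : Status) : List Status :=
  List.replicate (sonCount p s - 1) Status.white ++ [Status.black]

/-- The statuses of the root and of the sons of the nodes `1, .., ν`, in the order of the
numbering. -/
def rightmostWord (p : ℕ) : ℕ → List Status
  | 0 => [Status.black]
  | ν + 1 => rightmostWord p ν ++
      rightmostRow p ((rightmostWord p ν).getD ν Status.white)

/-- The status of the node `n` under the rightmost assignment. -/
def rightmostStat (p n : ℕ) : Status :=
  (rightmostWord p (n - 1)).getD (n - 1) Status.white

theorem sonCount_pos {p : ℕ} (hp : 5 ≤ p) (s : Status) : 2 ≤ sonCount p s := by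
  cases s <;> simp [sonCount, Status.num] <;> omega

theorem length_rightmostRow {p : ℕ} (hp : 5 ≤ p) (s : Status) :
    (rightmostRow p s).length = sonCount p s := by
  have := sonCount_pos hp s
  simp [rightmostRow]
  omega

theorem lt_length_rightmostWord {p : ℕ} (hp : 5 ≤ p) (ν : ℕ) :
    ν < (rightmostWord p ν).length := by
  induction ν with
  | zero => simp [rightmostWord]
  | succ ν ih =>
    have h1 := length_rightmostRow hp ((rightmostWord p ν).getD ν Status.white)
    have h2 := sonCount_pos hp ((rightmostWord p ν).getD ν Status.white)
    rw [rightmostWord, List.length_append]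
    omega

theorem getD_rightmostWord {p : ℕ} {ν i : ℕ} (hi : i < (rightmostWord p ν).length) (k : ℕ) :
    (rightmostWord p (ν + k)).getD i Status.white = (rightmostWord p ν).getD i Status.white ∧
      i < (rightmostWord p (ν + k)).length := by
  induction k with
  | zero => exact ⟨rfl, hi⟩
  | succ k ih =>
    rw [← Nat.add_assoc, rightmostWord]
    refine ⟨?_, ?_⟩
    · rw [List.getD_append _ _ _ _ ih.2, ih.1]
    · rw [List.length_append]
      omega

theorem rightmostRow_eq_black {p : ℕ} (s : Status) (i : ℕ) (hi : i < sonCount p s) :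
    (rightmostRow p s).getD i Status.white = Status.black ↔ i + 1 = sonCount p s := by
  unfold rightmostRow
  rcases Nat.lt_or_ge i (sonCount p s - 1) with h | h
  · rw [List.getD_append _ _ _ _ (by simpa using h)]
    simp [h]
    omega
  · have h0 : i - (sonCount p s - 1) = 0 := by omega
    rw [List.getD_append_right _ _ _ _ (by simpa using h)]
    simp [h0]
    omega

/-- The rightmost assignment `ρ`: the black son of each node is its rightmost son. -/
def rightmost (p : ℕ) (hp : 5 ≤ p) : Assignment p where
  first ν := (rightmostWord p (ν - 1)).length + 1
  pos ν := sonCount p (rightmostStat p ν)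
  stat := rightmostStat p
  stat_root := rfl
  first_root := rfl
  first_succ := by
    intro ν hν
    obtain ⟨k, rfl⟩ : ∃ k, ν = k + 1 := ⟨ν - 1, by omega⟩
    simp only [Nat.add_sub_cancel, rightmostStat, rightmostWord, List.length_append,
      length_rightmostRow hp]
    omega
  pos_mem := by
    intro ν _
    have := sonCount_pos hp (rightmostStat p ν)
    omega
  stat_son := by
    intro ν hν i hi
    obtain ⟨k, rfl⟩ : ∃ k, ν = k + 1 := ⟨ν - 1, by omega⟩
    rw [← rightmostRow_eq_black _ i hi]
    have hk := lt_length_rightmostWord hp k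
    set L := (rightmostWord p k).length with hL
    have hlen : L + i < (rightmostWord p (k + 1)).length := by
      rw [rightmostWord, List.length_append, length_rightmostRow hp]
      simp only [rightmostStat, Nat.add_sub_cancel] at hi
      omega
    have h1 := (getD_rightmostWord hlen (L + i - (k + 1))).1
    have h2 : k + 1 + (L + i - (k + 1)) = L + i := by omega
    rw [h2] at h1
    have h3 : (rightmostWord p (k + 1)).getD (L + i) Status.white
        = (rightmostRow p (rightmostStat p (k + 1))).getD i Status.white := by
      rw [rightmostWord, List.getD_append_right _ _ _ _ (by omega), ← hL]
      simp [rightmostStat]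
    have h4 : rightmostStat p (L + 1 + i) = (rightmostWord p (L + i)).getD (L + i) Status.white := by
      have h5 : L + 1 + i - 1 = L + i := by omega
      simp only [rightmostStat, h5]
    simp only [Nat.add_sub_cancel]
    rw [h4, h1, h3]

/-! ### The rules and the table -/

/-- The kinds of nodes that the rules distinguish: the root `r`, the other black nodes `b` and
the white nodes `w`. -/
inductive Kind where
  | r
  | b
  | w

/-- The kind of the node `ν` under `α`. -/
def Assignment.kind {p : ℕ} (α : Assignment p) (ν : ℕ) : Kind :=
  if ν = 1 then Kind.r else
    match α.stat ν with
    | .black => Kind.b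
    | .white => Kind.w

/-- The white nodes with the consecutive signatures `i, .., j`. -/
def whites (i j : ℕ) : List (Status × ℕ) :=
  (List.range' i (j + 1 - i)).map fun a => (Status.white, a)

/-- The right-hand sides of the rules
`r1 → w2, .., wd, bx`,   `b → w1, .., wc, bd`,
`wa → w1, .., wd, bx` for `1 < a < x`,   `w1, wx → wx, w1, .., wc, bd`,
for a node of the given kind and of signature `a`. -/
def rules (p : ℕ) : Kind → ℕ → List (Status × ℕ)
  | .r, _ => whites 2 (p - 3) ++ [(Status.black, p - 2)]
  | .b, _ => whites 1 (p - 4) ++ [(Status.black, p - 3)]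
  | .w, a =>
    if a = 1 ∨ a = p - 2 then
      (Status.white, p - 2) :: whites 1 (p - 4) ++ [(Status.black, p - 3)]
    else whites 1 (p - 3) ++ [(Status.black, p - 2)]

/-- The table of the codes of the sons: the code of the `h`-th son of a node of the given kind
and of signature `a`, where `u` is the code of `ν - 1` and `v` is the code of `ν - 2`. -/
def table (p : ℕ) : Kind → ℕ → List ℕ → List ℕ → ℕ → List ℕ
  | .r, _, _, _, h => if h ≤ p - 4 then [h + 1] else [p - 2]
  | .b, _, u, _, h => u ++ [h]
  | .w, a, u, v, h =>
    if a = 1 ∨ a = p - 2 then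
      if h = 1 then v ++ [p - 2] else u ++ [h - 1]
    else
      if h ≤ p - 3 then u ++ [h] else u ++ [p - 2]

end MetallicTree

namespace MetallicTree

/-! ### Reversed words

Words are handled with the rightmost digit first. -/

/-! Codes can be enumerated by counting with carries. On reversed words, `increment` preserves
admissibility, raises the value by one and reaches every nonempty admissible word, so `revCode p n`
is the only code of `n` (`eq_revCode`). The numbers coded by `[n]a` form the block from `shift p n +
1` to `shift p (n + 1)` (`revCode_shift_add`). This block has `p - 3` members if `[n]` is saturated,
`p - 2` otherwise, and the positive numbers with saturated code are exactly the last members of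
blocks (`saturated_revCode_iff`).

Under `ρ` a row of sons is short when its father is black, and, apart from the root, the black nodes
are the last members of rows. The two partitions into rows and blocks thus obey nearly the same
recursion. A strong induction (`first_rightmost`) shows that they stay in step: the first son of `ν
+ 1` is `shift p ν` or `shift p ν + 1`. Hence each black node other than the root is a saturated
number or immediately precedes one. Comparing rows with blocks yields the table and the rules, and
places the successor `shift p ν + 1` among the first two sons of `ν + 1`.

For an arbitrary assignment, the first son of `ν + 1` comes earlier the more black nodes there are
up to `ν`. Black sons placed last delay black nodes most, so `ρ` has the latest first sons
(`first_le_first_rightmost`). All sons of `ν` are therefore at most `shift p ν`, whereas any number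
coded by `[ν]a` exceeds it. -/

/-- The reversed word `r` begins with `d^j x` for some `j ≥ 0`. -/
def saturated (p : ℕ) : List ℕ → Bool
  | [] => false
  | a :: r => a == p - 2 || (a == p - 3 && saturated p r)

/-- The reversed word `r` is the reverse of an admissible word. -/
def Admissible (p : ℕ) : List ℕ → Prop
  | [] => True
  | a :: r => Admissible p r ∧ 1 ≤ a ∧ a ≤ p - 2 ∧ ¬ (a = p - 2 ∧ saturated p r = true)

/-- The number `∑ i, a_i m_{k+i}` for the reversed word `a_0 a_1 ..`. -/
def shiftedValue (p : ℕ) : ℕ → List ℕ → ℤ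
  | _, [] => 0
  | k, a :: r => (a : ℤ) * metallic p k + shiftedValue p (k + 1) r

/-- The reversed code of the next integer. -/
def increment (p : ℕ) : List ℕ → List ℕ
  | [] => [1]
  | a :: r => if saturated p (a :: r) then 1 :: increment p r else (a + 1) :: r

/-- The reversed nzm-code of `n`. -/
def revCode (p n : ℕ) : List ℕ := (increment p)^[n] []

/-- The number whose code would be `[n]0`. -/
def shift (p : ℕ) : ℕ → ℕ
  | 0 => 0
  | n + 1 => shift p n + (if saturated p (revCode p n) then p - 3 else p - 2)

theorem saturated_iff_prefix (p : ℕ) (r : List ℕ) :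
    saturated p r = true ↔ ∃ k, (List.replicate k (p - 3) ++ [p - 2]) <+: r := by
  induction r with
  | nil => simp [saturated]
  | cons a r ih =>
    rw [saturated, Bool.or_eq_true, Bool.and_eq_true, ih, beq_iff_eq, beq_iff_eq]
    constructor
    · rintro (h | ⟨h, k, hk⟩)
      · exact ⟨0, by simp [h]⟩
      · refine ⟨k + 1, ?_⟩
        rw [List.replicate_succ, List.cons_append, List.cons_prefix_cons]
        exact ⟨h.symm, hk⟩
    · rintro ⟨k, hk⟩
      cases k with
      | zero =>
        left
        simpa [eq_comm] using hk
      | succ k =>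
        rw [List.replicate_succ, List.cons_append, List.cons_prefix_cons] at hk
        exact Or.inr ⟨hk.1.symm, k, hk.2⟩

/-- Each forbidden block is a palindrome. -/
theorem hasForbiddenPattern_reverse (p : ℕ) (r : List ℕ) :
    HasForbiddenPattern p r.reverse ↔ HasForbiddenPattern p r := by
  have h : ∀ k, ([p - 2] ++ List.replicate k (p - 3) ++ [p - 2]).reverse
      = [p - 2] ++ List.replicate k (p - 3) ++ [p - 2] := by
    intro k
    simp
  unfold HasForbiddenPattern
  refine exists_congr fun k => ?_
  rw [← List.reverse_infix, List.reverse_reverse, h]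

theorem hasForbiddenPattern_cons (p a : ℕ) (r : List ℕ) :
    HasForbiddenPattern p (a :: r) ↔
      (a = p - 2 ∧ saturated p r = true) ∨ HasForbiddenPattern p r := by
  unfold HasForbiddenPattern
  rw [saturated_iff_prefix]
  simp only [List.infix_cons_iff, List.nil_append, List.cons_append,
    List.cons_prefix_cons, exists_or, exists_and_left, eq_comm (a := a)]

theorem admissible_iff (p : ℕ) (r : List ℕ) :
    Admissible p r ↔ (∀ a ∈ r, 1 ≤ a ∧ a ≤ p - 2) ∧ ¬ HasForbiddenPattern p r := by
  induction r with
  | nil => simp [Admissible, HasForbiddenPattern]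
  | cons a r ih =>
    rw [Admissible, ih, hasForbiddenPattern_cons, List.forall_mem_cons]
    tauto

theorem shiftedValue_append_singleton (p k b : ℕ) (r : List ℕ) :
    shiftedValue p k (r ++ [b]) = shiftedValue p k r + b * metallic p (k + r.length) := by
  induction r generalizing k with
  | nil => simp [shiftedValue]
  | cons a r ih =>
    rw [List.cons_append, shiftedValue, ih, shiftedValue, List.length_cons,
      show k + 1 + r.length = k + (r.length + 1) by omega]
    ring

theorem shiftedValue_reverse (p : ℕ) (w : List ℕ) :
    shiftedValue p 0 w.reverse = value p w := by
  induction w with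
  | nil => rfl
  | cons a w ih =>
    rw [List.reverse_cons, shiftedValue_append_singleton, ih, value, List.length_reverse,
      Nat.zero_add, add_comm]

theorem isNzmCode_iff (p n : ℕ) (w : List ℕ) :
    IsNzmCode p n w ↔ Admissible p w.reverse ∧ shiftedValue p 0 w.reverse = n := by
  rw [admissible_iff, hasForbiddenPattern_reverse, shiftedValue_reverse]
  simp only [List.mem_reverse]
  exact ⟨fun h => ⟨⟨h.digits, h.allowed⟩, h.value_eq⟩, fun h => ⟨h.1.1, h.1.2, h.2⟩⟩

/-! ### Counting by carries and uniqueness of codes -/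

theorem metallic_pos {p : ℕ} (hp : 5 ≤ p) (k : ℕ) :
    0 < metallic p k ∧ metallic p k ≤ metallic p (k + 1) := by
  have hp' : (5 : ℤ) ≤ p := by exact_mod_cast hp
  induction k with
  | zero =>
    simp only [metallic]
    omega
  | succ k ih =>
    refine ⟨by omega, ?_⟩
    obtain ⟨h1, h2⟩ := ih
    rw [metallic]
    nlinarith [mul_nonneg (sub_nonneg.2 hp') (h1.trans_le h2).le]

theorem shiftedValue_nonneg {p : ℕ} (hp : 5 ≤ p) (k : ℕ) (r : List ℕ) :
    0 ≤ shiftedValue p k r := by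
  induction r generalizing k with
  | nil => exact le_rfl
  | cons a r ih =>
    have := (metallic_pos hp k).1
    have := ih (k + 1)
    rw [shiftedValue]
    positivity

theorem Admissible.increment {p : ℕ} (hp : 5 ≤ p) {r : List ℕ} (hr : Admissible p r) :
    Admissible p (increment p r) := by
  induction r with
  | nil =>
    simp only [MetallicTree.increment, Admissible]
    simp [saturated]
    omega
  | cons a r ih =>
    rw [MetallicTree.increment]
    obtain ⟨h1, h2, h3, h4⟩ := hr
    split_ifs with h
    · exact ⟨ih h1, le_rfl, by omega, by omega⟩
    · simp only [saturated, Bool.or_eq_true, Bool.and_eq_true, beq_iff_eq, not_or, not_and] at h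
      refine ⟨h1, by omega, by omega, fun h5 => h.2 (by omega) h5.2⟩

/-- A carry resets the last digit to `1`. The recursion `(p - 2) m_{k+1} = m_{k+2} + m_k` then
leaves a deficit of `m_k`. In the case of a last digit `d`, the deficit passed on by the saturated
rest makes up for the digit being one less than `x`. -/
theorem shiftedValue_succ_increment {p : ℕ} (hp : 5 ≤ p) {r : List ℕ} (hr : Admissible p r)
    (k : ℕ) :
    shiftedValue p (k + 1) (increment p r) = shiftedValue p (k + 1) r + metallic p (k + 1) -
      if saturated p r then metallic p k else 0 := by
  induction r generalizing k with
  | nil => simp [increment, shiftedValue, saturated]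
  | cons a r ih =>
    obtain ⟨h1, h2, h3, h4⟩ := hr
    rw [increment]
    split_ifs with h
    · rw [shiftedValue, ih h1, shiftedValue, metallic]
      simp only [saturated, Bool.or_eq_true, Bool.and_eq_true, beq_iff_eq] at h
      rcases h with h | ⟨h, hs⟩
      · have hs : saturated p r = false := by simpa [h] using h4
        have ha : (a : ℤ) = p - 2 := by omega
        rw [hs, ha]
        push_cast
        ring
      · have ha : (a : ℤ) = p - 3 := by omega
        rw [if_pos hs, ha]
        push_cast
        ring
    · rw [shiftedValue, shiftedValue]
      push_cast
      ring

/-- At the lowest place `m_1 = (p - 2) m_0` has no correction term, so a carry there leaves no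
deficit. -/
theorem shiftedValue_increment {p : ℕ} (hp : 5 ≤ p) {r : List ℕ} (hr : Admissible p r) :
    shiftedValue p 0 (increment p r) = shiftedValue p 0 r + 1 := by
  cases r with
  | nil => simp [increment, shiftedValue, metallic]
  | cons a r =>
    obtain ⟨h1, h2, h3, h4⟩ := hr
    rw [increment]
    split_ifs with h
    · rw [shiftedValue, shiftedValue_succ_increment hp h1, shiftedValue, metallic]
      simp only [saturated, Bool.or_eq_true, Bool.and_eq_true, beq_iff_eq] at h
      rcases h with h | ⟨h, hs⟩
      · have hs : saturated p r = false := by simpa [h] using h4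
        have ha : (a : ℤ) = p - 2 := by omega
        rw [hs, ha]
        simp only [Bool.false_eq_true, if_false, metallic]
        push_cast
        ring
      · have ha : (a : ℤ) = p - 3 := by omega
        rw [if_pos hs, ha]
        simp only [metallic]
        push_cast
        ring
    · rw [shiftedValue, shiftedValue, metallic]
      push_cast
      ring

/-- Undoing a carry replaces a final `1` by the largest digit allowed after the decremented prefix:
`d` if that prefix is saturated, `x` otherwise. -/
theorem exists_increment_eq {p : ℕ} (hp : 5 ≤ p) {r : List ℕ} (hr : Admissible p r)
    (hne : r ≠ []) : ∃ s, Admissible p s ∧ increment p s = r := by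
  induction r with
  | nil => exact absurd rfl hne
  | cons a r ih =>
    obtain ⟨h1, h2, h3, h4⟩ := hr
    rcases Nat.lt_or_ge 1 a with ha | ha
    · refine ⟨(a - 1) :: r, ⟨h1, by omega, by omega, by omega⟩, ?_⟩
      rw [increment, if_neg, Nat.sub_add_cancel h2]
      simp only [saturated, Bool.or_eq_true, Bool.and_eq_true, beq_iff_eq, not_or, not_and]
      exact ⟨by omega, fun h5 h6 => h4 ⟨by omega, h6⟩⟩
    · obtain rfl : a = 1 := by omega
      rcases eq_or_ne r [] with rfl | hr
      · exact ⟨[], trivial, rfl⟩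
      · obtain ⟨s, hs, rfl⟩ := ih h1 hr
        cases hsat : saturated p s with
        | false =>
          refine ⟨(p - 2) :: s, ⟨hs, by omega, le_rfl, by simp [hsat]⟩, ?_⟩
          rw [increment, if_pos (by simp [saturated])]
        | true =>
          refine ⟨(p - 3) :: s, ⟨hs, by omega, by omega, by omega⟩, ?_⟩
          rw [increment, if_pos (by simp [saturated, hsat])]

theorem revCode_zero (p : ℕ) : revCode p 0 = [] := rfl

theorem revCode_succ (p n : ℕ) : revCode p (n + 1) = increment p (revCode p n) :=
  Function.iterate_succ_apply' _ _ _

theorem admissible_revCode {p : ℕ} (hp : 5 ≤ p) (n : ℕ) : Admissible p (revCode p n) := by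
  induction n with
  | zero => trivial
  | succ n ih =>
    rw [revCode_succ]
    exact ih.increment hp

theorem shiftedValue_revCode {p : ℕ} (hp : 5 ≤ p) (n : ℕ) :
    shiftedValue p 0 (revCode p n) = n := by
  induction n with
  | zero => rfl
  | succ n ih =>
    rw [revCode_succ, shiftedValue_increment hp (admissible_revCode hp n), ih]
    push_cast
    rfl

theorem eq_revCode {p : ℕ} (hp : 5 ≤ p) {n : ℕ} {r : List ℕ} (hr : Admissible p r)
    (hv : shiftedValue p 0 r = n) : r = revCode p n := by
  induction n generalizing r with
  | zero =>
    by_contra hne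
    obtain ⟨s, hs, rfl⟩ := exists_increment_eq hp hr hne
    have := shiftedValue_nonneg hp 0 s
    rw [shiftedValue_increment hp hs] at hv
    push_cast at hv
    omega
  | succ n ih =>
    rcases eq_or_ne r [] with rfl | hne
    · simp only [shiftedValue] at hv
      omega
    · obtain ⟨s, hs, rfl⟩ := exists_increment_eq hp hr hne
      rw [shiftedValue_increment hp hs] at hv
      push_cast at hv
      rw [revCode_succ, ih hs (by omega)]

theorem isNzmCode_iff_eq {p : ℕ} (hp : 5 ≤ p) (n : ℕ) (w : List ℕ) :
    IsNzmCode p n w ↔ w = (revCode p n).reverse := by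
  rw [isNzmCode_iff]
  constructor
  · rintro ⟨h1, h2⟩
    rw [← eq_revCode hp h1 h2, List.reverse_reverse]
  · rintro rfl
    rw [List.reverse_reverse]
    exact ⟨admissible_revCode hp n, shiftedValue_revCode hp n⟩

theorem nzmCode_eq {p : ℕ} (hp : 5 ≤ p) (n : ℕ) : nzmCode p n = (revCode p n).reverse := by
  have h : IsNzmCode p n (nzmCode p n) :=
    Classical.epsilon_spec (p := IsNzmCode p n) ⟨_, (isNzmCode_iff_eq hp n _).2 rfl⟩
  exact (isNzmCode_iff_eq hp n _).1 h

theorem revCode_injective {p : ℕ} (hp : 5 ≤ p) : Function.Injective (revCode p) := by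
  intro m n h
  have h1 := shiftedValue_revCode hp m
  rw [h, shiftedValue_revCode hp n] at h1
  exact_mod_cast h1.symm

theorem nzmSignature_eq {p : ℕ} (hp : 5 ≤ p) {n a : ℕ} {r : List ℕ} (h : revCode p n = a :: r) :
    nzmSignature p n = a := by
  rw [nzmSignature, nzmCode_eq hp, h]
  simp

/-! ### The shift -/

theorem shift_succ (p n : ℕ) :
    shift p (n + 1) = shift p n + (if saturated p (revCode p n) then p - 3 else p - 2) := rfl

theorem shift_bounds {p : ℕ} (hp : 5 ≤ p) (n : ℕ) :
    shift p n + 2 ≤ shift p (n + 1) ∧ shift p n + (p - 3) ≤ shift p (n + 1) ∧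
      shift p (n + 1) ≤ shift p n + (p - 2) := by
  rw [shift_succ]
  split_ifs <;> omega

theorem strictMono_shift {p : ℕ} (hp : 5 ≤ p) : StrictMono (shift p) :=
  strictMono_nat_of_lt_succ fun n => by
    have := shift_bounds hp n
    omega

/-- Counting inside a block only raises the last digit. The last member of a block is saturated, so
the next step carries into `[n]` and opens the block of `n + 1` with the digit `1`. -/
theorem revCode_shift_add {p : ℕ} (hp : 5 ≤ p) {n a : ℕ} (ha : 1 ≤ a)
    (h : shift p n + a ≤ shift p (n + 1)) : revCode p (shift p n + a) = a :: revCode p n := by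
  induction n generalizing a with
  | zero =>
    induction a, ha using Nat.le_induction with
    | base => rfl
    | succ a ha ih =>
      rw [← Nat.add_assoc, revCode_succ, ih (by omega), increment, if_neg]
      rw [shift_succ] at h
      simp [saturated, revCode_zero] at h ⊢
      omega
  | succ n ihn =>
    induction a, ha using Nat.le_induction with
    | base =>
      have hb := shift_bounds hp n
      have h1 := @ihn (shift p (n + 1) - shift p n) (by omega) (by omega)
      rw [Nat.add_sub_cancel' (by omega)] at h1
      rw [revCode_succ, h1, increment, if_pos, ← revCode_succ]
      rw [shift_succ, Nat.add_sub_cancel_left]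
      split_ifs with hs <;> simp [saturated, hs]
    | succ a ha ih =>
      rw [← Nat.add_assoc, revCode_succ, ih (by omega), increment, if_neg]
      rw [shift_succ p (n + 1)] at h
      simp only [saturated, Bool.or_eq_true, Bool.and_eq_true, beq_iff_eq, not_or, not_and]
      split_ifs at h with hs
      · exact ⟨by omega, by omega⟩
      · exact ⟨by omega, fun _ => hs⟩

theorem exists_shift_add {p : ℕ} (hp : 5 ≤ p) {m : ℕ} (hm : 1 ≤ m) :
    ∃ n a, 1 ≤ a ∧ shift p n + a = m ∧ shift p n + a ≤ shift p (n + 1) := by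
  induction m, hm using Nat.le_induction with
  | base =>
    have := shift_bounds hp 0
    exact ⟨0, 1, le_rfl, rfl, by omega⟩
  | succ m _ ih =>
    obtain ⟨n, a, ha, rfl, h⟩ := ih
    rcases Nat.lt_or_ge (shift p n + a) (shift p (n + 1)) with h1 | h1
    · exact ⟨n, a + 1, by omega, by omega, by omega⟩
    · have := shift_bounds hp (n + 1)
      exact ⟨n + 1, 1, le_rfl, by omega, by omega⟩

theorem saturated_shift_add {p : ℕ} (hp : 5 ≤ p) {n a : ℕ} (ha : 1 ≤ a)
    (h : shift p n + a ≤ shift p (n + 1)) :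
    saturated p (revCode p (shift p n + a)) = true ↔ shift p n + a = shift p (n + 1) := by
  rw [revCode_shift_add hp ha h]
  rw [shift_succ] at h ⊢
  simp only [saturated, Bool.or_eq_true, Bool.and_eq_true, beq_iff_eq]
  split_ifs at h ⊢ with hs
  · simp only [hs, and_true]
    omega
  · simp only [hs, Bool.false_eq_true, and_false, or_false]
    omega

/-- The saturated codes are those of the shifts of the positive integers. -/
theorem saturated_revCode_iff {p : ℕ} (hp : 5 ≤ p) (m : ℕ) :
    saturated p (revCode p m) = true ↔ ∃ k, shift p (k + 1) = m := by
  rcases Nat.eq_zero_or_pos m with rfl | hm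
  · simp only [revCode_zero, saturated, Bool.false_eq_true, false_iff, not_exists]
    intro k
    have := shift_bounds hp k
    omega
  · obtain ⟨n, a, ha, rfl, h⟩ := exists_shift_add hp hm
    rw [saturated_shift_add hp ha h]
    constructor
    · intro h1
      exact ⟨n, h1.symm⟩
    · rintro ⟨k, hk⟩
      have h1 : n < k + 1 := (strictMono_shift hp).lt_iff_lt.1 (by omega)
      have h2 : k + 1 ≤ n + 1 := (strictMono_shift hp).le_iff_le.1 (by omega)
      obtain rfl : k = n := by omega
      exact hk.symm

/-! ### The shape of the tree under an assignment -/

theorem sonCount_of_black {p : ℕ} {s : Status} (h : s = Status.black) :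
    sonCount p s = p - 3 := by
  subst h
  simp only [sonCount, Status.num]
  omega

theorem sonCount_of_ne_black {p : ℕ} {s : Status} (h : s ≠ Status.black) :
    sonCount p s = p - 2 := by
  cases s with
  | black => exact absurd rfl h
  | white => rfl

namespace Assignment

variable {p : ℕ} (α : Assignment p)

theorem first_add_two_le (hp : 5 ≤ p) {ν : ℕ} (hν : 1 ≤ ν) :
    α.first ν + 2 ≤ α.first (ν + 1) := by
  have := sonCount_pos hp (α.stat ν)
  have := α.first_succ ν hν
  omega

theorem lt_first (hp : 5 ≤ p) {ν : ℕ} (hν : 1 ≤ ν) : ν < α.first ν := by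
  induction ν, hν using Nat.le_induction with
  | base => simp [α.first_root]
  | succ ν hν ih =>
    have := α.first_add_two_le hp hν
    omega

theorem first_add_two_le_of_lt (hp : 5 ≤ p) {μ ν : ℕ} (hμ : 1 ≤ μ) (h : μ < ν) :
    α.first μ + 2 ≤ α.first ν := by
  induction ν, (Nat.succ_le_of_lt h) using Nat.le_induction with
  | base => exact α.first_add_two_le hp hμ
  | succ ν hν ih =>
    have h1 : μ < ν := hν
    have := ih h1
    have := α.first_add_two_le hp (show 1 ≤ ν by omega)
    omega

theorem exists_eq_first_add {m : ℕ} (hp : 5 ≤ p) (hm : 2 ≤ m) :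
    ∃ k i, 1 ≤ k ∧ i < sonCount p (α.stat k) ∧ m = α.first k + i := by
  induction m, hm using Nat.le_induction with
  | base => exact ⟨1, 0, le_rfl, by have := sonCount_pos hp (α.stat 1); omega, α.first_root.symm⟩
  | succ m _ ih =>
    obtain ⟨k, i, hk, hi, rfl⟩ := ih
    rcases Nat.lt_or_ge (i + 1) (sonCount p (α.stat k)) with h | h
    · exact ⟨k, i + 1, hk, h, by omega⟩
    · have h1 := sonCount_pos hp (α.stat (k + 1))
      have h2 := α.first_succ k hk
      exact ⟨k + 1, 0, by omega, by omega, by omega⟩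

theorem mem_sons {σ ν : ℕ} :
    σ ∈ α.sons ν ↔ ∃ i, i < sonCount p (α.stat ν) ∧ α.first ν + i = σ := by
  simp [sons]

theorem length_sons (ν : ℕ) : (α.sons ν).length = sonCount p (α.stat ν) := by
  simp [sons]

theorem getElem?_sons {ν i : ℕ} (hi : i < sonCount p (α.stat ν)) :
    (α.sons ν)[i]? = some (α.first ν + i) := by
  simp [sons, hi]

/-! ### Counting the black nodes -/

/-- The number of black nodes among `1, .., n`. -/
def blackCount (n : ℕ) : ℕ := ∑ i ∈ Finset.range n, (α.stat (i + 1)).num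

theorem blackCount_succ (n : ℕ) :
    α.blackCount (n + 1) = α.blackCount n + (α.stat (n + 1)).num :=
  Finset.sum_range_succ _ _

theorem blackCount_mono : Monotone α.blackCount :=
  monotone_nat_of_le_succ fun n => by
    rw [blackCount_succ]
    omega

/-- Each black node has one son fewer than a white one; the position of a row is thus governed by
the count of black nodes before it. -/
theorem first_succ_add_blackCount (hp : 5 ≤ p) (n : ℕ) :
    α.first (n + 1) + α.blackCount n = 2 + n * (p - 2) := by
  induction n with
  | zero => simp [α.first_root, blackCount]
  | succ n ih =>
    have h1 := α.first_succ (n + 1) (by omega)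
    rw [blackCount_succ, h1, Nat.add_mul]
    have h2 : sonCount p (α.stat (n + 1)) + (α.stat (n + 1)).num = p - 2 := by
      cases α.stat (n + 1) <;> simp [sonCount, Status.num]
      omega
    omega

theorem num_son {ν i : ℕ} (hν : 1 ≤ ν) (hi : i < sonCount p (α.stat ν)) :
    (α.stat (α.first ν + i)).num = if i + 1 = α.pos ν then 1 else 0 := by
  have h := α.stat_son ν hν i hi
  split_ifs with h1
  · rw [h.2 h1]
    rfl
  · cases h2 : α.stat (α.first ν + i) with
    | black => exact absurd (h.1 h2) h1
    | white => rfl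

/-- There is one black node in each row of brothers. -/
theorem blackCount_first (hp : 5 ≤ p) (n : ℕ) :
    α.blackCount (α.first (n + 1) - 1) = n + 1 := by
  induction n with
  | zero => simp [α.first_root, blackCount, α.stat_root, Status.num]
  | succ n ih =>
    have h0 := α.lt_first hp (show 1 ≤ n + 1 by omega)
    have h1 := α.first_succ (n + 1) (by omega)
    have h2 := α.pos_mem (n + 1) (by omega)
    rw [h1, show α.first (n + 1) + sonCount p (α.stat (n + 1)) - 1
      = α.first (n + 1) - 1 + sonCount p (α.stat (n + 1)) by omega]
    rw [blackCount, Finset.sum_range_add, ← blackCount, ih]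
    congr 1
    -- The new row contributes the indicator of its unique black position, shifted because positions
    -- start at `1`.
    rw [Finset.sum_congr rfl fun i hi => ?_, Finset.sum_ite_eq_of_mem'
      (Finset.range (sonCount p (α.stat (n + 1)))) (α.pos (n + 1) - 1) (fun _ => 1)
      (Finset.mem_range.2 (by omega))]
    rw [show α.first (n + 1) - 1 + i + 1 = α.first (n + 1) + i by omega,
      α.num_son (by omega) (Finset.mem_range.1 hi)]
    congr 1
    exact propext (by omega)

end Assignment

/-! ### The rightmost assignment -/

variable {p : ℕ}

theorem rightmost_stat_son (hp : 5 ≤ p) {ν i : ℕ} (hν : 1 ≤ ν)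
    (hi : i < sonCount p ((rightmost p hp).stat ν)) :
    (rightmost p hp).stat ((rightmost p hp).first ν + i) = Status.black ↔
      i + 1 = sonCount p ((rightmost p hp).stat ν) :=
  (rightmost p hp).stat_son ν hν i hi

theorem rightmost_stat_eq_black_iff (hp : 5 ≤ p) {m : ℕ} (hm : 2 ≤ m) :
    (rightmost p hp).stat m = Status.black ↔ ∃ k, (rightmost p hp).first (k + 2) = m + 1 := by
  constructor
  · intro h
    obtain ⟨k, i, hk, hi, rfl⟩ := (rightmost p hp).exists_eq_first_add hp hm
    rw [rightmost_stat_son hp hk hi] at h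
    have := (rightmost p hp).first_succ k hk
    refine ⟨k - 1, ?_⟩
    rw [show k - 1 + 2 = k + 1 by omega]
    omega
  · rintro ⟨k, hk⟩
    have h1 : (rightmost p hp).first (k + 2) = _ := (rightmost p hp).first_succ (k + 1) (by omega)
    have h2 := sonCount_pos hp ((rightmost p hp).stat (k + 1))
    have h3 := (rightmost_stat_son hp (show 1 ≤ k + 1 by omega)
      (show sonCount p ((rightmost p hp).stat (k + 1)) - 1 < _ by omega)).2 (by omega)
    rwa [show (rightmost p hp).first (k + 1) + (sonCount p ((rightmost p hp).stat (k + 1)) - 1)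
      = m by omega] at h3

/-- Under the rightmost assignment, the sons of any other node come as early as possible. -/
theorem first_le_first_rightmost (hp : 5 ≤ p) (α : Assignment p) (n : ℕ) :
    α.first (n + 1) ≤ (rightmost p hp).first (n + 1) := by
  induction n using Nat.strong_induction_on with
  | _ n ih =>
  set ρ := rightmost p hp with hρ
  rcases Nat.eq_zero_or_pos n with rfl | hn
  · rw [α.first_root, ρ.first_root]
  obtain ⟨k, hk1, hk2⟩ : ∃ k, ρ.first (k + 1) ≤ n + 1 ∧ n + 1 < ρ.first (k + 2) := by
    obtain ⟨k, i, hk, hi, h⟩ := ρ.exists_eq_first_add hp (show 2 ≤ n + 1 by omega)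
    have := ρ.first_succ k hk
    refine ⟨k - 1, ?_⟩
    rw [show k - 1 + 2 = k + 1 by omega, show k - 1 + 1 = k by omega]
    omega
  -- Node `n + 1` lies in the row of `k + 1`, whose black node is last and so not yet counted among
  -- `1, .., n`.
  have h1 : ρ.blackCount n ≤ k + 1 := by
    have h2 := ρ.blackCount_first hp (k + 1)
    have h3 : ρ.stat (ρ.first (k + 2) - 1) = Status.black :=
      (rightmost_stat_eq_black_iff hp (by omega)).2 ⟨k, by rw [← hρ]; omega⟩
    have h4 := ρ.blackCount_succ (ρ.first (k + 2) - 2)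
    rw [show ρ.first (k + 2) - 2 + 1 = ρ.first (k + 2) - 1 by omega, h2, h3] at h4
    have h5 := ρ.blackCount_mono (show n ≤ ρ.first (k + 2) - 2 by omega)
    simp only [Status.num] at h4
    omega
  -- By induction the rows of `1, .., k` are already complete under `α`; they and the root supply `k
  -- + 1` black nodes.
  have h2 : k + 1 ≤ α.blackCount n := by
    have h3 := ρ.lt_first hp (show 1 ≤ k + 1 by omega)
    have h4 := ih k (by omega)
    rw [← α.blackCount_first hp k]
    exact α.blackCount_mono (by omega)
  have h3 := α.first_succ_add_blackCount hp n
  have h4 := ρ.first_succ_add_blackCount hp n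
  omega

/-! ### Comparison of rows with blocks -/

theorem shift_add_two_le_of_lt (hp : 5 ≤ p) {m n : ℕ} (h : m < n) :
    shift p m + 2 ≤ shift p n := by
  have h1 := shift_bounds hp m
  have h2 := (strictMono_shift hp).monotone (Nat.succ_le_of_lt h)
  simp only [Nat.succ_eq_add_one] at h2
  omega

theorem shift_one (p : ℕ) : shift p 1 = p - 2 := by
  simp [shift, revCode_zero, saturated]

/-- This growth makes the row or block ending near `n` belong to a smaller index, as the strong
induction below requires. -/
theorem le_shift_succ (hp : 5 ≤ p) (k : ℕ) : 2 * k + 3 ≤ shift p (k + 1) := by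
  induction k with
  | zero =>
    rw [shift_one]
    omega
  | succ k ih =>
    have := shift_bounds hp (k + 1)
    omega

/-- The code of `ν` is saturated, or `ν + 1` is a white node with a saturated code. This is the case
where the first son of `ν + 1` is `shift p ν` instead of `shift p ν + 1`. -/
def IsDelayed (p : ℕ) (hp : 5 ≤ p) (ν : ℕ) : Prop :=
  saturated p (revCode p ν) = true ∨
    (saturated p (revCode p (ν + 1)) = true ∧ (rightmost p hp).stat (ν + 1) ≠ Status.black)

/-- The first son of a node under the rightmost assignment. -/
theorem first_rightmost (hp : 5 ≤ p) (n : ℕ) :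
    ((rightmost p hp).first (n + 2) = shift p (n + 1) ∧ IsDelayed p hp (n + 1) ∨
      (rightmost p hp).first (n + 2) = shift p (n + 1) + 1 ∧ ¬ IsDelayed p hp (n + 1)) ∧
    (saturated p (revCode p n) = true → ¬ IsDelayed p hp (n + 1)) := by
  induction n using Nat.strong_induction_on with
  | _ n ih =>
  set ρ := rightmost p hp with hρ
  rcases n with _ | n
  · have h1 : ¬ IsDelayed p hp 1 := by
      rintro (h | ⟨h, -⟩) <;> obtain ⟨k, hk⟩ := (saturated_revCode_iff hp _).1 h <;>
        have := le_shift_succ hp k <;> omega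
    have h2 : ρ.first 2 = _ := ρ.first_succ 1 le_rfl
    rw [ρ.first_root, sonCount_of_black ρ.stat_root] at h2
    refine ⟨Or.inr ⟨?_, h1⟩, fun _ => h1⟩
    rw [shift_one]
    simp only [Nat.zero_add]
    omega
  have hf := ρ.first_succ (n + 2) (by omega)
  have hs := shift_succ p (n + 1)
  have ihn := (ih n (by omega)).1
  have hb : ∀ m, 2 ≤ m → (ρ.stat m = Status.black ↔ ∃ k, ρ.first (k + 2) = m + 1) :=
    fun m hm => rightmost_stat_eq_black_iff hp hm
  rw [show n + 2 + 1 = n + 1 + 2 by omega] at hf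
  cases hsat : saturated p (revCode p (n + 1)) with
  | true =>
    obtain ⟨k, hk⟩ := (saturated_revCode_iff hp _).1 hsat
    have hk1 := le_shift_succ hp k
    have ihk := ih (k + 1) (by omega)
    rw [if_pos hsat] at hs
    have hd : IsDelayed p hp (n + 1) := Or.inl hsat
    -- After the saturated number `n + 1`, the next one is at least two further. A gap of exactly
    -- two forces `k + 1` to be saturated, and the second clause of the induction then makes that
    -- next saturated number itself black.
    have key : ∀ j, shift p (j + 1) = n + 2 ∨ shift p (j + 1) = n + 3 →
        j = k + 1 ∧ shift p (j + 1) = n + 3 ∧ ρ.first (k + 3) = shift p (k + 2) + 1 := by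
      intro j hj
      have h1 : k + 1 < j + 1 := (strictMono_shift hp).lt_iff_lt.1 (by omega)
      have h2 := shift_add_two_le_of_lt hp h1
      have h3 : j + 1 ≤ k + 2 := by
        by_contra h
        have := shift_add_two_le_of_lt hp (show k + 1 < k + 2 by omega)
        have := shift_add_two_le_of_lt hp (show k + 2 < j + 1 by omega)
        omega
      obtain rfl : j = k + 1 := by omega
      have h4 : saturated p (revCode p (k + 1)) = true := by
        by_contra h
        have h5 := shift_succ p (k + 1)
        rw [if_neg h] at h5
        omega
      rcases ihk.1 with h5 | h5
      · exact absurd h5.2 (ihk.2 h4)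
      · exact ⟨rfl, by omega, h5.1⟩
    -- A black `n + 2` would need a saturated number at `n + 2` or `n + 3`, which `key` excludes. So
    -- a full row meets a short block and the delay ends.
    have hw : ρ.stat (n + 2) ≠ Status.black := by
      rw [Ne, hb _ (by omega)]
      rintro ⟨j, hj⟩
      have hj1 := ρ.lt_first hp (show 1 ≤ j + 2 by omega)
      rcases (ih j (by omega)).1 with ⟨h1, h2⟩ | ⟨h1, h2⟩
      · obtain ⟨rfl, h3, h4⟩ := key j (by omega)
        simp only [Nat.add_assoc, Nat.reduceAdd] at *
        omega
      · have := key j (by omega)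
        omega
    have hnd : ¬ IsDelayed p hp (n + 2) := by
      rintro (h | ⟨h, h'⟩) <;> obtain ⟨j, hj⟩ := (saturated_revCode_iff hp _).1 h
      · have := key j (by omega)
        omega
      · obtain ⟨rfl, h3, h4⟩ := key j (by omega)
        exact h' ((hb _ (by omega)).2 ⟨k + 1, by
          simp only [Nat.add_assoc, Nat.reduceAdd] at *
          omega⟩)
    rw [sonCount_of_ne_black hw] at hf
    refine ⟨Or.inr ⟨?_, hnd⟩, fun _ => hnd⟩
    rcases ihn with h | h
    · omega
    · exact absurd hd h.2
  | false =>
    rw [if_neg (by simp [hsat])] at hs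
    refine ⟨?_, fun h => by simp at h⟩
    by_cases hbl : ρ.stat (n + 2) = Status.black
    · have hnd : ¬ IsDelayed p hp (n + 1) := by
        rintro (h | h)
        · simp [hsat] at h
        · exact h.2 hbl
      -- The saturated partner of the black node `n + 2` is `n + 2` or `n + 3`. In the latter case
      -- `n + 3` is white, since consecutive row ends are at least two apart.
      have hd : IsDelayed p hp (n + 2) := by
        obtain ⟨j, hj⟩ := (hb _ (by omega)).1 hbl
        have hj1 := ρ.lt_first hp (show 1 ≤ j + 2 by omega)
        rcases (ih j (by omega)).1 with ⟨h1, -⟩ | ⟨h1, -⟩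
        · refine Or.inr ⟨(saturated_revCode_iff hp _).2 ⟨j, by omega⟩, fun h => ?_⟩
          obtain ⟨i, hi⟩ := (hb _ (by omega)).1 h
          rcases lt_trichotomy i j with hij | rfl | hij
          · have := ρ.first_add_two_le_of_lt hp (show 1 ≤ i + 2 by omega)
              (show i + 2 < j + 2 by omega)
            omega
          · omega
          · have := ρ.first_add_two_le_of_lt hp (show 1 ≤ j + 2 by omega)
              (show j + 2 < i + 2 by omega)
            omega
        · exact Or.inl ((saturated_revCode_iff hp _).2 ⟨j, by omega⟩)
      rw [sonCount_of_black hbl] at hf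
      refine Or.inl ⟨?_, hd⟩
      rcases ihn with h | h
      · exact absurd h.2 hnd
      · omega
    -- Row and block both have full length, so the delay must persist unchanged. A white saturated
    -- `n + 3` is impossible here, for its black partner would be `n + 2` or `n + 3`.
    · have hiff : IsDelayed p hp (n + 1) ↔ IsDelayed p hp (n + 2) := by
        constructor
        · rintro (h | h)
          · simp [hsat] at h
          · exact Or.inl h.1
        · rintro (h | ⟨h, h'⟩)
          · exact Or.inr ⟨h, hbl⟩
          · exfalso
            obtain ⟨j, hj⟩ := (saturated_revCode_iff hp _).1 h
            have hj1 := le_shift_succ hp j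
            rcases (ih j (by omega)).1 with ⟨h1, -⟩ | ⟨h1, -⟩
            · exact hbl ((hb _ (by omega)).2 ⟨j, by omega⟩)
            · exact h' ((hb _ (by omega)).2 ⟨j, by omega⟩)
      rw [sonCount_of_ne_black hbl] at hf
      rcases ihn with h | h
      · exact Or.inl ⟨by omega, hiff.1 h.2⟩
      · exact Or.inr ⟨by omega, fun h1 => h.2 (hiff.2 h1)⟩

/-! ### The codes of the sons -/

/-- If `[n + 1]` were saturated, row and block would both be short and the delay at `n + 1` would
persist, contrary to the second clause of `first_rightmost`. -/
theorem first_of_black (hp : 5 ≤ p) {n : ℕ}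
    (h : (rightmost p hp).stat (n + 2) = Status.black) :
    (rightmost p hp).first (n + 2) = shift p (n + 1) + 1 ∧
      shift p (n + 2) = shift p (n + 1) + (p - 2) := by
  have h1 := first_rightmost hp n
  have h2 := first_rightmost hp (n + 1)
  have h3 : (rightmost p hp).first (n + 3) = _ := (rightmost p hp).first_succ (n + 2) (by omega)
  have h4 := shift_succ p (n + 1)
  rw [sonCount_of_black h] at h3
  simp only [Nat.add_assoc, Nat.reduceAdd] at h1 h2 h4
  cases hsat : saturated p (revCode p (n + 1)) with
  | true =>
    rw [if_pos hsat] at h4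
    have h5 := h2.2 hsat
    have h6 : IsDelayed p hp (n + 1) := Or.inl hsat
    rcases h1.1 with h7 | h7
    · rcases h2.1 with h8 | h8
      · exact absurd h8.2 h5
      · omega
    · exact absurd h6 h7.2
  | false =>
    rw [if_neg (by simp [hsat])] at h4
    refine ⟨?_, h4⟩
    rcases h1.1 with ⟨-, h7 | h7⟩ | h7
    · simp [hsat] at h7
    · exact absurd h h7.2
    · exact h7.1

/-- The two sources of a delay match the two signatures: a number just after a block end has last
digit `1`, and a white block end has last digit `x`. -/
theorem isDelayed_iff_of_white (hp : 5 ≤ p) {n : ℕ}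
    (h : (rightmost p hp).stat (n + 2) ≠ Status.black) :
    IsDelayed p hp (n + 1) ↔ nzmSignature p (n + 2) = 1 ∨ nzmSignature p (n + 2) = p - 2 := by
  constructor
  · rintro (hd | ⟨hd, -⟩) <;> obtain ⟨j, hj⟩ := (saturated_revCode_iff hp _).1 hd
    · left
      have h1 := shift_bounds hp (j + 1)
      have h2 := revCode_shift_add hp le_rfl (show shift p (j + 1) + 1 ≤ _ by omega)
      rw [hj] at h2
      exact nzmSignature_eq hp h2
    · right
      have h1 := first_rightmost hp j
      have h2 := shift_succ p j
      have h3 := shift_bounds hp j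
      rw [if_neg] at h2
      · have h4 := revCode_shift_add hp (n := j) (a := p - 2) (by omega) (by omega)
        rw [← h2, hj] at h4
        exact nzmSignature_eq hp h4
      -- A block ending in `d` has a saturated prefix `[j]`; then there is no delay at `j + 1`, and
      -- the block end would be black.
      · intro hs
        rcases h1.1 with h4 | h4
        · exact h1.2 hs h4.2
        · refine h ((rightmost_stat_eq_black_iff hp (by omega)).2 ⟨j, by omega⟩)
  · obtain ⟨k, a, ha, hka, hle⟩ := exists_shift_add hp (show 1 ≤ n + 2 by omega)
    have h1 := revCode_shift_add hp ha hle
    rw [hka] at h1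
    rw [nzmSignature_eq hp h1]
    rintro (rfl | rfl)
    · left
      cases k with
      | zero =>
        simp only [shift] at hka
        omega
      | succ k => exact (saturated_revCode_iff hp _).2 ⟨k, by omega⟩
    · have h2 := shift_bounds hp k
      exact Or.inr ⟨(saturated_revCode_iff hp _).2 ⟨k, by omega⟩, h⟩

theorem kind_one (α : Assignment p) : α.kind 1 = Kind.r := by
  simp [Assignment.kind]

theorem kind_of_black (α : Assignment p) {ν : ℕ} (hν : 2 ≤ ν) (h : α.stat ν = Status.black) :
    α.kind ν = Kind.b := by
  rw [Assignment.kind, if_neg (by omega), h]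

theorem kind_of_white (α : Assignment p) {ν : ℕ} (hν : 2 ≤ ν) (h : α.stat ν ≠ Status.black) :
    α.kind ν = Kind.w := by
  rw [Assignment.kind, if_neg (by omega)]
  cases hs : α.stat ν with
  | black => exact absurd hs h
  | white => rfl

theorem nzmCode_shift_add (hp : 5 ≤ p) {n a m : ℕ} (hm : m = shift p n + a) (ha : 1 ≤ a)
    (h : m ≤ shift p (n + 1)) : nzmCode p m = nzmCode p n ++ [a] := by
  subst hm
  rw [nzmCode_eq hp, nzmCode_eq hp, revCode_shift_add hp ha h, List.reverse_cons]

theorem nzmCode_son (hp : 5 ≤ p) {ν i : ℕ} (hν : 1 ≤ ν)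
    (hi : i < sonCount p ((rightmost p hp).stat ν)) :
    nzmCode p ((rightmost p hp).first ν + i) =
      table p ((rightmost p hp).kind ν) (nzmSignature p ν) (nzmCode p (ν - 1))
        (nzmCode p (ν - 2)) (i + 1) := by
  set ρ := rightmost p hp with hρ
  obtain rfl | ⟨n, rfl⟩ : ν = 1 ∨ ∃ n, ν = n + 2 := by
    rcases Nat.lt_or_ge 1 ν with h | h
    · exact Or.inr ⟨ν - 2, by omega⟩
    · exact Or.inl (by omega)
  · rw [sonCount_of_black ρ.stat_root] at hi
    rw [kind_one, table, ρ.first_root]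
    have h0 : nzmCode p 0 = [] := by
      rw [nzmCode_eq hp]
      rfl
    have h1 := shift_one p
    have h2 : shift p 0 = 0 := rfl
    split_ifs with h
    · rw [nzmCode_shift_add hp (n := 0) (a := i + 1 + 1) (by omega) (by omega)
        (by simp only [Nat.zero_add]; omega), h0, List.nil_append]
    · rw [nzmCode_shift_add hp (n := 0) (a := p - 2) (by omega) (by omega)
        (by simp only [Nat.zero_add]; omega), h0, List.nil_append]
  have e1 : n + 2 - 1 = n + 1 := by omega
  have e2 : n + 2 - 2 = n := by omega
  have hb := shift_bounds hp (n + 1)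
  simp only [Nat.add_assoc, Nat.reduceAdd] at hb
  rw [e1, e2]
  by_cases h : ρ.stat (n + 2) = Status.black
  · have h1 := first_of_black hp h
    rw [sonCount_of_black h] at hi
    rw [kind_of_black ρ (by omega) h, table]
    exact nzmCode_shift_add hp (by rw [hρ]; omega) (by omega)
      (by simp only [Nat.add_assoc, Nat.reduceAdd]; rw [hρ]; omega)
  · have h1 := first_rightmost hp n
    have h2 := isDelayed_iff_of_white hp h
    rw [← hρ] at h1
    rw [sonCount_of_ne_black h] at hi
    rw [kind_of_white ρ (by omega) h, table]
    by_cases hd : IsDelayed p hp (n + 1)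
    · rw [if_pos (h2.1 hd)]
      have h3 : ρ.first (n + 2) = shift p (n + 1) := by
        rcases h1.1 with h4 | h4
        · exact h4.1
        · exact absurd hd h4.2
      -- With a delay, the first son is the last member of the block of `n`. Its digit is `x`
      -- because `[n]` is unsaturated; the other sons start the block of `n + 1`.
      split_ifs with hi1
      · have h4 := shift_succ p n
        rw [if_neg fun hs => h1.2 hs hd] at h4
        exact nzmCode_shift_add hp (by omega) (by omega) (by omega)
      · exact nzmCode_shift_add hp (by omega) (by omega)
          (by simp only [Nat.add_assoc, Nat.reduceAdd]; omega)
    · rw [if_neg fun hs => hd (h2.2 hs)]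
      have h3 : ρ.first (n + 2) = shift p (n + 1) + 1 := by
        rcases h1.1 with h4 | h4
        · exact absurd h4.2 hd
        · exact h4.1
      have h4 := shift_succ p (n + 1)
      rw [if_neg fun hs => hd (Or.inl hs)] at h4
      simp only [Nat.add_assoc, Nat.reduceAdd] at h4
      split_ifs with hi1
      · exact nzmCode_shift_add hp (by omega) (by omega)
          (by simp only [Nat.add_assoc, Nat.reduceAdd]; omega)
      · exact nzmCode_shift_add hp (by omega) (by omega)
          (by simp only [Nat.add_assoc, Nat.reduceAdd]; omega)

/-! ### The rules -/

theorem getElem?_whites_append {i j k : ℕ} (s : Status × ℕ) (hk : k ≤ j + 1 - i) :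
    (whites i j ++ [s])[k]? = some (if k = j + 1 - i then s else (Status.white, i + k)) := by
  have hl : (whites i j).length = j + 1 - i := by simp [whites]
  split_ifs with h
  · rw [List.getElem?_append_right (by omega), hl, h]
    simp
  · rw [List.getElem?_append_left (by omega)]
    simp [whites, show k < j + 1 - i by omega]

theorem length_whites (i j : ℕ) : (whites i j).length = j + 1 - i := by
  simp [whites]

theorem length_rules (hp : 5 ≤ p) (α : Assignment p) {ν : ℕ} (hν : 1 ≤ ν) (a : ℕ) :
    (rules p (α.kind ν) a).length = sonCount p (α.stat ν) := by
  rcases eq_or_ne ν 1 with rfl | h1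
  · rw [kind_one, sonCount_of_black α.stat_root]
    simp [rules, length_whites]
    omega
  by_cases h : α.stat ν = Status.black
  · rw [kind_of_black α (by omega) h, sonCount_of_black h]
    simp [rules, length_whites]
    omega
  · rw [kind_of_white α (by omega) h, sonCount_of_ne_black h, rules]
    split_ifs
    all_goals
      simp [length_whites]
      omega

/-- The rules give the last digits of the entries of the table. -/
theorem getElem?_rules (hp : 5 ≤ p) (α : Assignment p) {ν i : ℕ} (hν : 1 ≤ ν) (a : ℕ)
    (u v : List ℕ) (hi : i < sonCount p (α.stat ν)) :
    (rules p (α.kind ν) a)[i]? =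
      some (if i + 1 = sonCount p (α.stat ν) then Status.black else Status.white,
        (table p (α.kind ν) a u v (i + 1)).getLastD 0) := by
  rcases eq_or_ne ν 1 with rfl | h1
  · rw [sonCount_of_black α.stat_root] at hi ⊢
    rw [kind_one, rules, table, getElem?_whites_append _ (by omega)]
    split_ifs <;> first | omega | (simp; try omega)
  by_cases h : α.stat ν = Status.black
  · rw [sonCount_of_black h] at hi ⊢
    rw [kind_of_black α (by omega) h, rules, table,
      getElem?_whites_append _ (by omega)]
    split_ifs <;> first | omega | (simp; try omega)
  · rw [sonCount_of_ne_black h] at hi ⊢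
    rw [kind_of_white α (by omega) h, rules, table]
    by_cases ha : a = 1 ∨ a = p - 2
    · rw [if_pos ha, if_pos ha]
      cases i with
      | zero =>
        rw [if_neg (by omega), if_pos (by omega)]
        simp
      | succ i =>
        rw [List.cons_append, List.getElem?_cons_succ,
          getElem?_whites_append _ (by omega)]
        split_ifs <;> first | omega | (simp; try omega)
    · rw [if_neg ha, if_neg ha, getElem?_whites_append _ (by omega)]
      split_ifs <;> first | omega | (simp; try omega)

theorem map_sons_rightmost (hp : 5 ≤ p) {ν : ℕ} (hν : 1 ≤ ν) :
    ((rightmost p hp).sons ν).map (fun σ => ((rightmost p hp).stat σ, nzmSignature p σ)) =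
      rules p ((rightmost p hp).kind ν) (nzmSignature p ν) := by
  apply List.ext_getElem?
  intro i
  rcases Nat.lt_or_ge i (sonCount p ((rightmost p hp).stat ν)) with hi | hi
  · rw [List.getElem?_map, Assignment.getElem?_sons _ hi,
      getElem?_rules hp _ hν _ (nzmCode p (ν - 1)) (nzmCode p (ν - 2)) hi, ← nzmCode_son hp hν hi]
    have hs := rightmost_stat_son hp hν hi
    rw [Option.map_some, nzmSignature]
    congr 2
    split_ifs with h
    · exact hs.2 h
    · cases h1 : (rightmost p hp).stat ((rightmost p hp).first ν + i) with
      | black => exact absurd (hs.1 h1) h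
      | white => rfl
  · rw [List.getElem?_eq_none (by rwa [List.length_map, Assignment.length_sons]),
      List.getElem?_eq_none (by rwa [length_rules hp _ hν])]

/-! ### Successors and preferred sons -/

/-- No block is empty, so the digit `1` may follow any code. -/
theorem isSuccessor_iff (hp : 5 ≤ p) (ν n : ℕ) : IsSuccessor p ν n ↔ n = shift p ν + 1 := by
  have h1 := shift_bounds hp ν
  have h2 := revCode_shift_add hp le_rfl (show shift p ν + 1 ≤ _ by omega)
  rw [IsSuccessor, nzmCode_eq hp, nzmCode_eq hp, ← List.reverse_cons, ← h2,
    List.reverse_injective.eq_iff, (revCode_injective hp).eq_iff]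
  omega

theorem nzmCode_ne_of_mem_sons (hp : 5 ≤ p) (α : Assignment p) {ν σ : ℕ} (hν : 1 ≤ ν) (a : ℕ)
    (h : σ ∈ α.sons ν) : nzmCode p σ ≠ nzmCode p ν ++ [a] := by
  obtain ⟨i, hi, rfl⟩ := α.mem_sons.1 h
  have h1 := α.first_succ ν hν
  have h2 := first_le_first_rightmost hp α ν
  have h3 : (rightmost p hp).first (ν + 1) ≤ shift p ν + 1 := by
    have h4 := first_rightmost hp (ν - 1)
    rw [show ν - 1 + 2 = ν + 1 by omega, show ν - 1 + 1 = ν by omega] at h4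
    rcases h4.1 with h5 | h5 <;> omega
  have h4 := α.lt_first hp hν
  obtain ⟨k, b, hb, hkb, hle⟩ := exists_shift_add hp (show 1 ≤ α.first ν + i by omega)
  intro h5
  rw [nzmCode_eq hp, nzmCode_eq hp, ← List.reverse_cons, List.reverse_injective.eq_iff, ← hkb,
    revCode_shift_add hp hb hle, List.cons.injEq, (revCode_injective hp).eq_iff] at h5
  -- Now the son equals `shift p ν + b` with `b ≥ 1`, yet it precedes the first son of `ν + 1`,
  -- which is at most `shift p ν + 1`.
  rw [h5.2] at hkb
  omega

end MetallicTree

theorem mainTheorem4 (p : ℕ) (hp : 5 ≤ p) :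
    -- every positive integer has exactly one nzm-code, so that `nzmCode` is that code
    (∀ n, 1 ≤ n → ∃! w, MetallicTree.IsNzmCode p n w) ∧
    -- the statuses and the signatures of the sons are given by the rules
    (∀ ν, 1 ≤ ν →
      ((MetallicTree.rightmost p hp).sons ν).map
          (fun σ => ((MetallicTree.rightmost p hp).stat σ, MetallicTree.nzmSignature p σ)) =
        MetallicTree.rules p ((MetallicTree.rightmost p hp).kind ν)
          (MetallicTree.nzmSignature p ν)) ∧
    -- the codes of the sons are given by the table
    (∀ ν, 1 ≤ ν → ∀ h, 1 ≤ h → h ≤ ((MetallicTree.rightmost p hp).sons ν).length →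
      ∃ σ, ((MetallicTree.rightmost p hp).sons ν)[h - 1]? = some σ ∧
        MetallicTree.nzmCode p σ =
          MetallicTree.table p ((MetallicTree.rightmost p hp).kind ν)
            (MetallicTree.nzmSignature p ν)
            (MetallicTree.nzmCode p (ν - 1)) (MetallicTree.nzmCode p (ν - 2)) h) ∧
    -- the successor of `ν` is the first or the second son of `ν + 1`
    (∀ ν, 1 ≤ ν → ∃ σ, (∀ n, MetallicTree.IsSuccessor p ν n ↔ n = σ) ∧
      (((MetallicTree.rightmost p hp).sons (ν + 1))[0]? = some σ ∨
        ((MetallicTree.rightmost p hp).sons (ν + 1))[1]? = some σ)) ∧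
    -- no preferred son property under the rightmost assignment
    (∀ a, 1 ≤ a → a ≤ p - 2 → ¬ (MetallicTree.rightmost p hp).HasPreferredSons a) ∧
    -- no preferred son property, and even no preferred son of any node, under any assignment
    (∀ α : MetallicTree.Assignment p, ∀ a, 1 ≤ a → a ≤ p - 2 →
      ¬ α.HasPreferredSons a ∧
        ∀ ν, 1 ≤ ν → ∀ σ ∈ α.sons ν, MetallicTree.nzmCode p σ ≠ MetallicTree.nzmCode p ν ++ [a]) := by
  open MetallicTree in
  refine ⟨fun n _ => ⟨_, (isNzmCode_iff_eq hp n _).2 rfl, fun w => (isNzmCode_iff_eq hp n w).1⟩,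
    fun ν hν => map_sons_rightmost hp hν, ?_, ?_, ?_, ?_⟩
  · intro ν hν h h1 h2
    rw [Assignment.length_sons] at h2
    refine ⟨_, Assignment.getElem?_sons _ (by omega), ?_⟩
    rw [nzmCode_son hp hν (by omega), Nat.sub_add_cancel h1]
  · intro ν hν
    refine ⟨shift p ν + 1, isSuccessor_iff hp ν, ?_⟩
    have h1 := sonCount_pos hp ((rightmost p hp).stat (ν + 1))
    rw [Assignment.getElem?_sons _ (by omega), Assignment.getElem?_sons _ (by omega)]
    have h2 := (first_rightmost hp (ν - 1)).1
    rw [show ν - 1 + 2 = ν + 1 by omega, show ν - 1 + 1 = ν by omega] at h2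
    rcases h2 with h2 | h2
    · exact Or.inr (by rw [h2.1])
    · exact Or.inl (by rw [h2.1])
  · intro a _ _ h
    obtain ⟨σ, hσ, -⟩ := h 1 le_rfl
    exact nzmCode_ne_of_mem_sons hp _ le_rfl a hσ.1 hσ.2
  · intro α a _ _
    refine ⟨fun h => ?_, fun ν hν σ hσ => nzmCode_ne_of_mem_sons hp α hν a hσ⟩
    obtain ⟨σ, hσ, -⟩ := h 1 le_rfl
    exact nzmCode_ne_of_mem_sons hp _ le_rfl a hσ.1 hσ.2
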